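/- **Language.** Terms (up to renaming of bound variables) and values are given by \[ M,N,P ::= \mathsf{zero}\mid \mathsf{succ}(M)\mid \mathsf{pred}(M)\mid \mathsf{ifz}\;M\;\mathsf{then}\;N\;\mathsf{else}\;P\mid x\mid \lambda x.M\mid M\,N\mid \mathsf{fix}\,x.M\mid (M,N)\mid \mathsf{let}\,(x,y)=M\,\mathsf{in}\,N, \] \[ V,W ::= x\mid \underline n\mid (V,W)\mid \lambda x.M ,\qquad \underline n=\mathsf{succ}^n(\mathsf{zero}). \] One-step reduction $\rhd$ is the closure of the rules $\mathsf{ifz}\;\underline 0\;\mathsf{then}\;N\;\mathsf{else}\;P\rhd N$; $\mathsf{ifz}\;\underline{n+1}\;\mathsf{then}\;N\;\mathsf{else}\;P\rhd P$; $\mathsf{let}\,(x,y)=(V,W)\,\mathsf{in}\,M\rhd M[V/x,W/y]$; $\mathsf{fix}\,x.M\rhd M[\mathsf{fix}\,x.M/x]$; $\mathsf{pred}(\underline 0)\rhd\underline 0$; $\mathsf{pred}(\underline{n+1})\rhd\underline n$; $(\lambda x.M)V\rhd M[V/x]$ under the evaluation contexts \[ \mathcal E ::= \Box\mid \mathsf{succ}(\mathcal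 E)\mid\mathsf{pred}(\mathcal E)\mid(\mathcal E,M)\mid(V,\mathcal E)\mid \mathsf{let}\,(x,y)=\mathcal E\,\mathsf{in}\,N\mid \mathsf{ifz}\;\mathcal E\;\mathsf{then}\;N\;\mathsf{else}\;P\mid(\lambda x.M)\,\mathcal E\mid\mathcal E\,N . \] A normal form is a term that cannot make a step; $M$ normalises to $R$ if $M\rhd^* R$ and $R$ is a normal form; $M$ diverges, $M\Uparrow$, if it has no normal form; $M\Downarrow V$ means that $M$ is closed and $M\rhd^* V$ for the value $V$. **Types.** The finitely verifiable types $F$ and the types $A,B$ are \[ F ::= \mathsf{Ok}\mid\mathsf{Nat}\mid F_1\times F_2,\qquad A,B ::= \mathsf{Ok}\mid\mathsf{Nat}\mid A\times B\mid A\to B\mid A\succ F , \] where $A\succ F$ ("$A$ only to $F$") is the necessity arrow. With $\mathsf{Vals}_0$ the set of closed values, types denote the following sets of closed terms: \[ \begin{array}{l} [\![\mathsf{Ok}]\!]=\mathsf{Vals}_0,\qquad [\![\mathsf{Nat}]\!]=\{\underline n\mid n\in\mathbb N\},\qquad [\![A\times B]\!]=\{(V,W)\mid V\in[\![A]\!],\,W\in[\![B]\!]\},\\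 {}[\![A\to B]\!]=\{\lambda x.M \text{ closed}\mid \forall V\in\mathsf{Vals}_0.\ V\in[\![A]\!]\Rightarrow M[V/x]\in[\![B]\!]_\bot\},\\ {}[\![A\succ B]\!]=\{\lambda x.M\text{ closed}\mid \forall V\in\mathsf{Vals}_0.\ M[V/x]\in\mathcal T[\![B]\!]\Rightarrow V\in[\![A]\!]\},\\ \mathcal T[\![A]\!]=\{M\mid M\Downarrow V \text{ for some } V\in[\![A]\!]\},\qquad [\![A]\!]_\bot=\{M\text{ closed}\mid M\in\mathcal T[\![A]\!]\text{ or }M\Uparrow\}. \end{array} \] The fixpoint approximants are $\mathsf{fix}^0x.M=\mathsf{div}$, where $\mathsf{div}=\mathsf{fix}\,x.x$, and $\mathsf{fix}^{k+1}x.M=M[\mathsf{fix}^kx.M/x]$. For closed terms $N,P$ write $P\lesssim N$ if, whenever $P$ normalises, $N$ normalises to the same normal form. A context $C$ is a term with holes (any number of them, possibly under binders), and $C[M]$ is the result of filling all holes with $M$; free variables of $M$ may be captured. **Theorem (Types are safety properties).** Let $A$ be a type and $C$ a context. 1. For all closed terms $N$ and $P$: if $C[N]\in[\![A]\!]_\bot$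 and $P\lesssim N$, then $C[P]\in[\![A]\!]_\bot$. 2. For every term $M$: if $C[\mathsf{fix}\,x.M]\notin[\![A]\!]_\bot$, then there is some $k\in\mathbb N$ with $C[\mathsf{fix}^k x.M]\notin[\![A]\!]_\bot$. -/

import Mathlib

namespace TwoSided

/-- Terms up to renaming of bound variables, represented by de Bruijn indices.  `lam M` and
`fix M` bind index `0` of `M`.  `letp M N` is `let (x, y) = M in N`; in `N` the variable `x` is
index `1` and `y` is index `0`. -/
inductive Term : Type where
  | zero : Term
  | succ : Term → Term
  | pred : Term → Term
  | ifz : Term → Term → Term → Term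
  | var : ℕ → Term
  | lam : Term → Term
  | app : Term → Term → Term
  | fix : Term → Term
  | pair : Term → Term → Term
  | letp : Term → Term → Term

/-- Extend a renaming under one binder. -/
def upRen (ρ : ℕ → ℕ) : ℕ → ℕ
  | 0 => 0
  | i + 1 => ρ i + 1

namespace Term

/-- Renaming of the free variables. -/
def rename : (ℕ → ℕ) → Term → Term
  | _, zero => zero
  | ρ, succ M => succ (rename ρ M)
  | ρ, pred M => pred (rename ρ M)
  | ρ, ifz M N P => ifz (rename ρ M) (rename ρ N) (rename ρ P)
  | ρ, var i => var (ρ i)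
  | ρ, lam M => lam (rename (upRen ρ) M)
  | ρ, app M N => app (rename ρ M) (rename ρ N)
  | ρ, fix M => fix (rename (upRen ρ) M)
  | ρ, pair M N => pair (rename ρ M) (rename ρ N)
  | ρ, letp M N => letp (rename ρ M) (rename (upRen (upRen ρ)) N)

end Term

/-- Extend a substitution under one binder. -/
def upSub (σ : ℕ → Term) : ℕ → Term
  | 0 => Term.var 0
  | i + 1 => (σ i).rename Nat.succ

namespace Term

/-- Capture-avoiding parallel substitution. -/
def subst : (ℕ → Term) → Term → Term
  | _, zero => zero
  | σ, succ M => succ (subst σ M)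
  | σ, pred M => pred (subst σ M)
  | σ, ifz M N P => ifz (subst σ M) (subst σ N) (subst σ P)
  | σ, var i => σ i
  | σ, lam M => lam (subst (upSub σ) M)
  | σ, app M N => app (subst σ M) (subst σ N)
  | σ, fix M => fix (subst (upSub σ) M)
  | σ, pair M N => pair (subst σ M) (subst σ N)
  | σ, letp M N => letp (subst σ M) (subst (upSub (upSub σ)) N)

/-- The substitution that sends index `0` to `N` and lowers every other index by one. -/
def single (N : Term) : ℕ → Term
  | 0 => N
  | i + 1 => var i

/-- The substitution that sends index `1` to `V`, index `0` to `W` and lowers every other index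
by two. -/
def double (V W : Term) : ℕ → Term
  | 0 => W
  | 1 => V
  | i + 2 => var i

/-- `M[N/x]`, where `x` is index `0` of `M`. -/
def inst (M N : Term) : Term := M.subst (single N)

/-- `M[V/x, W/y]`, where `x` is index `1` and `y` is index `0` of `M`. -/
def inst₂ (M V W : Term) : Term := M.subst (double V W)

/-- All free variables have index below `n`. -/
def ClosedAt : ℕ → Term → Prop
  | _, zero => True
  | n, succ M => ClosedAt n M
  | n, pred M => ClosedAt n M
  | n, ifz M N P => ClosedAt n M ∧ ClosedAt n N ∧ ClosedAt n P
  | n, var i => i < n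
  | n, lam M => ClosedAt (n + 1) M
  | n, app M N => ClosedAt n M ∧ ClosedAt n N
  | n, fix M => ClosedAt (n + 1) M
  | n, pair M N => ClosedAt n M ∧ ClosedAt n N
  | n, letp M N => ClosedAt n M ∧ ClosedAt (n + 2) N

/-- A term without free variables. -/
def Closed (M : Term) : Prop := M.ClosedAt 0

/-- The numeral `succⁿ(zero)`. -/
def num : ℕ → Term
  | 0 => zero
  | n + 1 => succ (num n)

/-- `div` is `fix x. x`. -/
def div : Term := fix (var 0)

/-- The fixpoint approximants: `fix⁰ x. M = div` and `fixⁿ⁺¹ x. M = M[fixⁿ x. M / x]`. -/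
def fixApprox : ℕ → Term → Term
  | 0, _ => div
  | n + 1, M => M.inst (fixApprox n M)

end Term

open Term

/-- The (possibly open) values. -/
inductive IsValue : Term → Prop where
  | var (i : ℕ) : IsValue (var i)
  | num (n : ℕ) : IsValue (num n)
  | pair {V W : Term} : IsValue V → IsValue W → IsValue (pair V W)
  | lam (M : Term) : IsValue (lam M)

/-- One-step call-by-value reduction: the closure of the redex rules under evaluation contexts
(one closure rule for each production of the grammar of evaluation contexts). -/
inductive Step : Term → Term → Prop where
  | ifZ (N P : Term) : Step (ifz (num 0) N P) N
  | ifS (n : ℕ) (N P : Term) : Step (ifz (num (n + 1)) N P) P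
  | letPair {V W : Term} (M : Term) :
      IsValue V → IsValue W → Step (letp (pair V W) M) (M.inst₂ V W)
  | unfold (M : Term) : Step (fix M) (M.inst (fix M))
  | predZ : Step (pred (num 0)) (num 0)
  | predS (n : ℕ) : Step (pred (num (n + 1))) (num n)
  | beta (M : Term) {V : Term} : IsValue V → Step (app (lam M) V) (M.inst V)
  | succ {M M' : Term} : Step M M' → Step (succ M) (succ M')
  | pred {M M' : Term} : Step M M' → Step (pred M) (pred M')
  | pairL {M M' : Term} (N : Term) : Step M M' → Step (pair M N) (pair M' N)
  | pairR {V N N' : Term} : IsValue V → Step N N' → Step (pair V N) (pair V N')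
  | letp {M M' : Term} (N : Term) : Step M M' → Step (letp M N) (letp M' N)
  | ifz {M M' : Term} (N P : Term) : Step M M' → Step (ifz M N P) (ifz M' N P)
  | appR (M : Term) {N N' : Term} : Step N N' → Step (app (lam M) N) (app (lam M) N')
  | appL {M M' : Term} (N : Term) : Step M M' → Step (app M N) (app M' N)

/-- The reflexive transitive closure of one-step reduction. -/
def Steps : Term → Term → Prop := Relation.ReflTransGen Step

/-- A term that cannot make a step. -/
def NormalForm (M : Term) : Prop := ∀ N, ¬ Step M N

/-- `M` normalises to the normal form `R`. -/
def NormalisesTo (M R : Term) : Prop := Steps M R ∧ NormalForm R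

/-- A term that has no normal form. -/
def Diverges (M : Term) : Prop := ¬ ∃ R, NormalisesTo M R

/-- `M ⇓ V`: the closed term `M` evaluates to the value `V`. -/
def Evaluates (M V : Term) : Prop := M.Closed ∧ IsValue V ∧ Steps M V

/-- `P ≲ N`: if `P` normalises, then `N` normalises to the same normal form. -/
def Below (P N : Term) : Prop := ∀ R, NormalisesTo P R → NormalisesTo N R

/-- Type expressions: `arrow A B` is the sufficiency arrow `A → B` and `nec A B` is the necessity
arrow, "`A` only to `B`".  The restriction on the right of necessity arrows is `IsType`. -/
inductive Ty : Type where
  | ok : Ty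
  | nat : Ty
  | prod : Ty → Ty → Ty
  | arrow : Ty → Ty → Ty
  | nec : Ty → Ty → Ty

/-- The finitely verifiable types. -/
inductive FinitelyVerifiable : Ty → Prop where
  | ok : FinitelyVerifiable Ty.ok
  | nat : FinitelyVerifiable Ty.nat
  | prod {F G : Ty} :
      FinitelyVerifiable F → FinitelyVerifiable G → FinitelyVerifiable (Ty.prod F G)

/-- The types: necessity arrows have only finitely verifiable types on the right. -/
inductive IsType : Ty → Prop where
  | ok : IsType Ty.ok
  | nat : IsType Ty.nat
  | prod {A B : Ty} : IsType A → IsType B → IsType (Ty.prod A B)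
  | arrow {A B : Ty} : IsType A → IsType B → IsType (Ty.arrow A B)
  | nec {A F : Ty} : IsType A → FinitelyVerifiable F → IsType (Ty.nec A F)

/-- The closed terms that evaluate to a member of `X`. -/
def evalTo (X : Set Term) : Set Term := {M | ∃ V ∈ X, Evaluates M V}

/-- The closed terms that evaluate to a member of `X` or diverge. -/
def evalToOrDiverge (X : Set Term) : Set Term :=
  {M | M.Closed ∧ (M ∈ evalTo X ∨ Diverges M)}

/-- `Vals₀`, the closed values. -/
def closedValues : Set Term := {V | V.Closed ∧ IsValue V}

/-- `⟦A⟧`, the closed values of type `A`. -/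
def sem : Ty → Set Term
  | Ty.ok => closedValues
  | Ty.nat => {V | ∃ n : ℕ, V = num n}
  | Ty.prod A B => {U | ∃ V ∈ sem A, ∃ W ∈ sem B, U = pair V W}
  | Ty.arrow A B => {U | U.Closed ∧ ∃ M, U = lam M ∧
      ∀ V ∈ closedValues, V ∈ sem A → M.inst V ∈ evalToOrDiverge (sem B)}
  | Ty.nec A B => {U | U.Closed ∧ ∃ M, U = lam M ∧
      ∀ V ∈ closedValues, M.inst V ∈ evalTo (sem B) → V ∈ sem A}

/-- `⟦A⟧⊥`, the closed terms that evaluate to a value of type `A` or diverge. -/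
def semBot (A : Ty) : Set Term := evalToOrDiverge (sem A)

/-- Term contexts with any number of holes, which may stand under binders.  Filling a hole may
capture variables of the inserted term: the label `ρ` of a hole says which variable, in the scope
of that hole, each free variable of the inserted term becomes.  A one-hole context in the
literal sense has the label `id`; labels let holes at different depths refer to the same
variable. -/
inductive Ctx : Type where
  | hole : (ℕ → ℕ) → Ctx
  | zero : Ctx
  | succ : Ctx → Ctx
  | pred : Ctx → Ctx
  | ifz : Ctx → Ctx → Ctx → Ctx
  | var : ℕ → Ctx
  | lam : Ctx → Ctx
  | app : Ctx → Ctx → Ctx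
  | fix : Ctx → Ctx
  | pair : Ctx → Ctx → Ctx
  | letp : Ctx → Ctx → Ctx

/-- `C[M]`: the term obtained by replacing every hole of `C` by `M`. -/
def Ctx.fill : Ctx → Term → Term
  | .hole ρ, M => M.rename ρ
  | .zero, _ => .zero
  | .succ C, M => .succ (C.fill M)
  | .pred C, M => .pred (C.fill M)
  | .ifz C D E, M => .ifz (C.fill M) (D.fill M) (E.fill M)
  | .var i, _ => .var i
  | .lam C, M => .lam (C.fill M)
  | .app C D, M => .app (C.fill M) (D.fill M)
  | .fix C, M => .fix (C.fill M)
  | .pair C D, M => .pair (C.fill M) (D.fill M)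
  | .letp C D, M => .letp (C.fill M) (D.fill M)

end TwoSided

/-! Both claims are instances of one fact: membership in `semBot A` passes from terms `T k` to a
term `S` that `T k` simulates at level `k`, for every `k`. In the first, `S` is `C[P]` and `T` is
constantly `C[N]`; in the second, `T k` is `C[fixᵏ x. M]` and `S` is `C[fix x. M]`.

The relation `Sim k` contains the basic pairs and is a congruence closed under substitution, so
holes may be copied and may stand under binders. A step on the left costs at most one level, because
unfolding `fix` consumes one approximant on the right (`Sim.step`). A left normal form is matched by
a right one at any level, values by similar values and stuck terms by stuck terms
(`Sim.normalForm`). Hence if `S` normalises in `n` steps, so does every `T (k + n)`, to a normal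
form that agrees at level `k` (`Sim.normalisesTo`).

It remains to pass to the limit in the values, by induction on the type
(`mem_sem_of_forall_valueSim`). Necessity arrows are contravariant in their result: there membership
moves from left to right, which works because finitely verifiable types see only numerals, pairs and
being a value (`FinitelyVerifiable.mem_sem`). -/

namespace TwoSided

namespace Term

/-! ### Renaming and substitution -/

theorem subst_congr {σ σ' : ℕ → Term} (h : ∀ i, σ i = σ' i) (M : Term) :
    M.subst σ = M.subst σ' := by
  rw [funext h]

theorem upRen_comp (ρ ρ' : ℕ → ℕ) (i : ℕ) :
    upRen ρ' (upRen ρ i) = upRen (fun i => ρ' (ρ i)) i := by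
  cases i <;> rfl

theorem rename_rename (M : Term) (ρ ρ' : ℕ → ℕ) :
    (M.rename ρ).rename ρ' = M.rename fun i => ρ' (ρ i) := by
  induction M generalizing ρ ρ' <;> simp_all [rename, upRen_comp]

theorem upSub_upRen (ρ : ℕ → ℕ) (σ : ℕ → Term) (i : ℕ) :
    upSub σ (upRen ρ i) = upSub (fun i => σ (ρ i)) i := by
  cases i <;> rfl

theorem subst_rename (M : Term) (ρ : ℕ → ℕ) (σ : ℕ → Term) :
    (M.rename ρ).subst σ = M.subst fun i => σ (ρ i) := by
  induction M generalizing ρ σ <;> simp_all [rename, subst, upSub_upRen]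

theorem rename_upSub (ρ : ℕ → ℕ) (σ : ℕ → Term) (i : ℕ) :
    (upSub σ i).rename (upRen ρ) = upSub (fun i => (σ i).rename ρ) i := by
  cases i with
  | zero => rfl
  | succ i => simp [upSub, rename_rename, upRen]

theorem rename_subst (M : Term) (σ : ℕ → Term) (ρ : ℕ → ℕ) :
    (M.subst σ).rename ρ = M.subst fun i => (σ i).rename ρ := by
  induction M generalizing ρ σ <;> simp_all [rename, subst, rename_upSub]

theorem subst_upSub (σ τ : ℕ → Term) (i : ℕ) :
    (upSub σ i).subst (upSub τ) = upSub (fun i => (σ i).subst τ) i := by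
  cases i with
  | zero => rfl
  | succ i => simp [upSub, subst_rename, rename_subst]

theorem subst_subst (M : Term) (σ τ : ℕ → Term) :
    (M.subst σ).subst τ = M.subst fun i => (σ i).subst τ := by
  induction M generalizing σ τ <;> simp_all [subst, subst_upSub]

theorem upSub_var : upSub var = var := by
  funext i
  cases i <;> rfl

theorem subst_var (M : Term) : M.subst var = M := by
  induction M <;> simp_all [subst, upSub_var]

theorem inst_rename (M N : Term) (ρ : ℕ → ℕ) :
    (M.inst N).rename ρ = (M.rename (upRen ρ)).inst (N.rename ρ) := by
  simp only [inst, rename_subst, subst_rename]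
  exact subst_congr (fun i => by cases i <;> rfl) M

theorem inst_subst (M N : Term) (σ : ℕ → Term) :
    (M.inst N).subst σ = (M.subst (upSub σ)).inst (N.subst σ) := by
  simp only [inst, subst_subst]
  refine subst_congr (fun i => ?_) M
  cases i with
  | zero => rfl
  | succ i => simpa [upSub, subst_rename, single, subst] using (subst_var (σ i)).symm

theorem fixApprox_rename (k : ℕ) (M : Term) (ρ : ℕ → ℕ) :
    (fixApprox k M).rename ρ = fixApprox k (M.rename (upRen ρ)) := by
  induction k with
  | zero => rfl
  | succ k ih => simp [fixApprox, inst_rename, ih]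

/-- Approximants transform under substitution exactly as `fix M` does; this keeps the pairs of a
fixpoint and its approximants stable in `Sim.subst`. -/
theorem fixApprox_subst (k : ℕ) (M : Term) (σ : ℕ → Term) :
    (fixApprox k M).subst σ = fixApprox k (M.subst (upSub σ)) := by
  induction k with
  | zero => rfl
  | succ k ih => simp [fixApprox, inst_subst, ih]

/-! ### Closed terms -/

theorem ClosedAt.upRen_eq {n : ℕ} {ρ : ℕ → ℕ} (h : ∀ i < n, ρ i = i) :
    ∀ i < n + 1, upRen ρ i = i
  | 0, _ => rfl
  | i + 1, hi => by simp [upRen, h i (by omega)]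

theorem ClosedAt.rename_eq {n : ℕ} {M : Term} {ρ : ℕ → ℕ} (hM : M.ClosedAt n)
    (h : ∀ i < n, ρ i = i) : M.rename ρ = M := by
  induction M generalizing n ρ with
  | zero => rfl
  | var i => simp [rename, h i hM]
  | succ M ih | pred M ih => simp [rename, ih hM h]
  | lam M ih | fix M ih => simp [rename, ih hM (upRen_eq h)]
  | app M N ih₁ ih₂ | pair M N ih₁ ih₂ => simp [rename, ih₁ hM.1 h, ih₂ hM.2 h]
  | ifz M N P ih₁ ih₂ ih₃ => simp [rename, ih₁ hM.1 h, ih₂ hM.2.1 h, ih₃ hM.2.2 h]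
  | letp M N ih₁ ih₂ => simp [rename, ih₁ hM.1 h, ih₂ hM.2 (upRen_eq (upRen_eq h))]

theorem ClosedAt.upSub_eq {n : ℕ} {σ : ℕ → Term} (h : ∀ i < n, σ i = var i) :
    ∀ i < n + 1, upSub σ i = var i
  | 0, _ => rfl
  | i + 1, hi => by simp [upSub, h i (by omega), rename]

theorem ClosedAt.subst_eq {n : ℕ} {M : Term} {σ : ℕ → Term} (hM : M.ClosedAt n)
    (h : ∀ i < n, σ i = var i) : M.subst σ = M := by
  induction M generalizing n σ with
  | zero => rfl
  | var i => simp [subst, h i hM]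
  | succ M ih | pred M ih => simp [subst, ih hM h]
  | lam M ih | fix M ih => simp [subst, ih hM (upSub_eq h)]
  | app M N ih₁ ih₂ | pair M N ih₁ ih₂ => simp [subst, ih₁ hM.1 h, ih₂ hM.2 h]
  | ifz M N P ih₁ ih₂ ih₃ => simp [subst, ih₁ hM.1 h, ih₂ hM.2.1 h, ih₃ hM.2.2 h]
  | letp M N ih₁ ih₂ => simp [subst, ih₁ hM.1 h, ih₂ hM.2 (upSub_eq (upSub_eq h))]

theorem Closed.rename_eq {M : Term} (hM : M.Closed) (ρ : ℕ → ℕ) : M.rename ρ = M :=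
  ClosedAt.rename_eq hM fun _ h => absurd h (Nat.not_lt_zero _)

theorem Closed.subst_eq {M : Term} (hM : M.Closed) (σ : ℕ → Term) : M.subst σ = M :=
  ClosedAt.subst_eq hM fun _ h => absurd h (Nat.not_lt_zero _)

theorem closedAt_upRen {m n : ℕ} {ρ : ℕ → ℕ} (h : ∀ i < m, ρ i < n) :
    ∀ i < m + 1, upRen ρ i < n + 1
  | 0, _ => by simp [upRen]
  | i + 1, hi => by simpa [upRen] using h i (by omega)

theorem ClosedAt.rename {m n : ℕ} {M : Term} {ρ : ℕ → ℕ} (hM : M.ClosedAt m)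
    (h : ∀ i < m, ρ i < n) : (M.rename ρ).ClosedAt n := by
  induction M generalizing m n ρ with
  | zero => trivial
  | var i => exact h i hM
  | succ M ih | pred M ih => exact ih hM h
  | lam M ih | fix M ih => exact ih hM (closedAt_upRen h)
  | app M N ih₁ ih₂ | pair M N ih₁ ih₂ => exact ⟨ih₁ hM.1 h, ih₂ hM.2 h⟩
  | ifz M N P ih₁ ih₂ ih₃ => exact ⟨ih₁ hM.1 h, ih₂ hM.2.1 h, ih₃ hM.2.2 h⟩
  | letp M N ih₁ ih₂ => exact ⟨ih₁ hM.1 h, ih₂ hM.2 (closedAt_upRen (closedAt_upRen h))⟩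

theorem closedAt_upSub {m n : ℕ} {σ : ℕ → Term} (h : ∀ i < m, (σ i).ClosedAt n) :
    ∀ i < m + 1, (upSub σ i).ClosedAt (n + 1)
  | 0, _ => by simp [upSub, ClosedAt]
  | i + 1, hi => (h i (by omega)).rename fun _ hj => Nat.succ_lt_succ hj

theorem ClosedAt.subst {m n : ℕ} {M : Term} {σ : ℕ → Term} (hM : M.ClosedAt m)
    (h : ∀ i < m, (σ i).ClosedAt n) : (M.subst σ).ClosedAt n := by
  induction M generalizing m n σ with
  | zero => trivial
  | var i => exact h i hM
  | succ M ih | pred M ih => exact ih hM h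
  | lam M ih | fix M ih => exact ih hM (closedAt_upSub h)
  | app M N ih₁ ih₂ | pair M N ih₁ ih₂ => exact ⟨ih₁ hM.1 h, ih₂ hM.2 h⟩
  | ifz M N P ih₁ ih₂ ih₃ => exact ⟨ih₁ hM.1 h, ih₂ hM.2.1 h, ih₃ hM.2.2 h⟩
  | letp M N ih₁ ih₂ => exact ⟨ih₁ hM.1 h, ih₂ hM.2 (closedAt_upSub (closedAt_upSub h))⟩

theorem ClosedAt.inst {M N : Term} (hM : M.ClosedAt 1) (hN : N.Closed) : (M.inst N).Closed :=
  hM.subst fun i hi => by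
    obtain rfl : i = 0 := by omega
    exact hN

theorem ClosedAt.inst₂ {M V W : Term} (hM : M.ClosedAt 2) (hV : V.Closed) (hW : W.Closed) :
    (M.inst₂ V W).Closed :=
  hM.subst fun i hi => by
    match i, hi with
    | 0, _ => exact hW
    | 1, _ => exact hV

theorem ClosedAt.of_rename_succ {m : ℕ} {N : Term}
    (h : (N.rename Nat.succ).ClosedAt (m + 1)) : N.ClosedAt m := by
  -- The substitution undoes the shift; its value at index `0` is an arbitrary closed term, since
  -- that index does not occur.
  have := h.subst (n := m) (σ := fun i => Nat.casesOn i zero var) (by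
    rintro (_ | i) hi
    · trivial
    · exact Nat.lt_of_succ_lt_succ hi)
  rw [subst_rename] at this
  rwa [show (fun i => (Nat.casesOn (Nat.succ i) zero var : Term)) = var from rfl,
    subst_var] at this

theorem upSub_reflects {m n : ℕ} {σ : ℕ → Term} (h : ∀ i, (σ i).ClosedAt n → i < m) :
    ∀ i, (upSub σ i).ClosedAt (n + 1) → i < m + 1
  | 0, _ => by omega
  | i + 1, hi => Nat.succ_lt_succ (h i (ClosedAt.of_rename_succ hi))

/-- Every free index `i` of `M` leaves a copy of `σ i` in the result, so bounds are reflected as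
soon as `σ` reflects them. -/
theorem ClosedAt.of_subst {m n : ℕ} {M : Term} {σ : ℕ → Term} (hM : (M.subst σ).ClosedAt n)
    (h : ∀ i, (σ i).ClosedAt n → i < m) : M.ClosedAt m := by
  induction M generalizing m n σ with
  | zero => trivial
  | var i => exact h i hM
  | succ M ih | pred M ih => exact ih hM h
  | lam M ih | fix M ih => exact ih hM (upSub_reflects h)
  | app M N ih₁ ih₂ | pair M N ih₁ ih₂ => exact ⟨ih₁ hM.1 h, ih₂ hM.2 h⟩
  | ifz M N P ih₁ ih₂ ih₃ => exact ⟨ih₁ hM.1 h, ih₂ hM.2.1 h, ih₃ hM.2.2 h⟩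
  | letp M N ih₁ ih₂ => exact ⟨ih₁ hM.1 h, ih₂ hM.2 (upSub_reflects (upSub_reflects h))⟩

theorem ClosedAt.of_inst {n : ℕ} {M N : Term} (h : (M.inst N).ClosedAt n) :
    M.ClosedAt (n + 1) :=
  h.of_subst fun i hi => by
    cases i with
    | zero => omega
    | succ i => exact Nat.succ_lt_succ hi

theorem num_injective : Function.Injective num := by
  intro m n h
  induction m generalizing n with
  | zero => cases n <;> simp_all [num]
  | succ m ih =>
    cases n with
    | zero => simp [num] at h
    | succ n => rw [ih (by simpa [num] using h)]

theorem num_ne_lam (n : ℕ) (M : Term) : num n ≠ lam M := by cases n <;> simp [num]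

theorem num_ne_pair (n : ℕ) (M N : Term) : num n ≠ pair M N := by cases n <;> simp [num]

theorem succ_eq_num {M : Term} {n : ℕ} (h : succ M = num n) : ∃ m, n = m + 1 ∧ M = num m := by
  cases n with
  | zero => simp [num] at h
  | succ m => exact ⟨m, rfl, by simpa [num] using h⟩

end Term

open Term

/-- Each hole has its own label and its own depth, hence the quantifiers over `ρ` and `n` in the
hypothesis. -/
theorem Ctx.fill_closedAt {N P : Term}
    (h : ∀ ρ n, (N.rename ρ).ClosedAt n → (P.rename ρ).ClosedAt n) (C : Ctx) {n : ℕ}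
    (hC : (C.fill N).ClosedAt n) : (C.fill P).ClosedAt n := by
  induction C generalizing n with
  | hole ρ => exact h ρ n hC
  | zero => trivial
  | var i => exact hC
  | succ C ih | pred C ih | lam C ih | fix C ih => exact ih hC
  | app C D ih₁ ih₂ | pair C D ih₁ ih₂ | letp C D ih₁ ih₂ => exact ⟨ih₁ hC.1, ih₂ hC.2⟩
  | ifz C D E ih₁ ih₂ ih₃ => exact ⟨ih₁ hC.1, ih₂ hC.2.1, ih₃ hC.2.2⟩

/-! ### Values and reduction -/

theorem IsValue.exists_num {M : Term} (h : IsValue (Term.succ M)) : ∃ n, M = Term.num n := by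
  generalize hU : Term.succ M = U at h
  cases h with
  | num n =>
    obtain ⟨m, -, rfl⟩ := succ_eq_num hU
    exact ⟨m, rfl⟩
  | _ => cases hU

theorem IsValue.of_pair {M N : Term} (h : IsValue (Term.pair M N)) : IsValue M ∧ IsValue N := by
  generalize hU : Term.pair M N = U at h
  cases h with
  | num n => exact absurd hU.symm (num_ne_pair _ _ _)
  | pair hV hW => cases hU; exact ⟨hV, hW⟩
  | _ => cases hU

theorem not_step_num (n : ℕ) (M : Term) : ¬ Step (num n) M := by
  induction n generalizing M with
  | zero => rintro ⟨⟩
  | succ n ih =>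
    intro h
    cases h with
    | succ h => exact ih _ h

theorem IsValue.normalForm {V : Term} (h : IsValue V) : NormalForm V := by
  induction h with
  | var i => rintro _ ⟨⟩
  | num n => exact not_step_num n
  | lam M => rintro _ ⟨⟩
  | pair _ _ ih₁ ih₂ =>
    intro N h
    cases h with
    | pairL _ h => exact ih₁ _ h
    | pairR _ h => exact ih₂ _ h

theorem IsValue.not_step {V W : Term} (h : IsValue V) (hs : Step V W) : False :=
  h.normalForm W hs

theorem Step.closed {M M' : Term} (h : Step M M') (hM : M.Closed) : M'.Closed := by
  induction h with
  | ifZ N P => exact hM.2.1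
  | ifS n N P => exact hM.2.2
  | letPair M _ _ => exact ClosedAt.inst₂ hM.2 hM.1.1 hM.1.2
  | unfold M => exact ClosedAt.inst (M := M) hM hM
  | predZ => trivial
  | predS n => exact hM
  | beta M _ => exact ClosedAt.inst (M := M) hM.1 hM.2
  | succ _ ih | pred _ ih => exact ih hM
  | pairL N _ ih | letp N _ ih | appL N _ ih => exact ⟨ih hM.1, hM.2⟩
  | pairR _ _ ih | appR M _ ih => exact ⟨hM.1, ih hM.2⟩
  | ifz N P _ ih => exact ⟨ih hM.1, hM.2⟩

theorem Steps.closed {M M' : Term} (h : Steps M M') (hM : M.Closed) : M'.Closed := by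
  induction h with
  | refl => exact hM
  | tail _ h ih => exact h.closed ih

/-- Values do not step, so the redex is unique. The purpose is uniqueness of normal forms. -/
theorem Step.deterministic {M N N' : Term} (h : Step M N) (h' : Step M N') : N = N' := by
  induction h generalizing N' with
  | ifZ N P =>
    cases h' with
    | ifZ => rfl
    | ifz _ _ h => exact (not_step_num 0 _ h).elim
  | ifS n N P =>
    generalize hQ : num (n + 1) = Q at h'
    cases h' with
    | ifZ => cases hQ
    | ifS => rfl
    | ifz _ _ h => exact (not_step_num (n + 1) _ (hQ ▸ h)).elim
  | letPair M hV hW =>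
    cases h' with
    | letPair => rfl
    | letp _ h => exact ((hV.pair hW).not_step h).elim
  | unfold M => cases h'; rfl
  | predZ =>
    cases h' with
    | predZ => rfl
    | pred h => exact (not_step_num 0 _ h).elim
  | predS n =>
    generalize hQ : num (n + 1) = Q at h'
    cases h' with
    | predZ => cases hQ
    | predS m => rw [Nat.succ_injective (num_injective hQ)]
    | pred h => exact (not_step_num (n + 1) _ (hQ ▸ h)).elim
  | beta M hV =>
    cases h' with
    | beta => rfl
    | appR _ h => exact (hV.not_step h).elim
    | appL _ h => cases h
  | succ _ ih =>
    cases h' with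
    | succ h => rw [ih h]
  | pred hs ih =>
    cases h' with
    | predZ => exact (not_step_num 0 _ hs).elim
    | predS n => exact (not_step_num (n + 1) _ hs).elim
    | pred h => rw [ih h]
  | pairL N hs ih =>
    cases h' with
    | pairL _ h => rw [ih h]
    | pairR hV _ => exact (hV.not_step hs).elim
  | pairR hV _ ih =>
    cases h' with
    | pairL _ h => exact (hV.not_step h).elim
    | pairR _ h => rw [ih h]
  | letp N hs ih =>
    cases h' with
    | letPair _ hV hW => exact ((hV.pair hW).not_step hs).elim
    | letp _ h => rw [ih h]
  | ifz N P hs ih =>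
    cases h' with
    | ifZ => exact (not_step_num 0 _ hs).elim
    | ifS n => exact (not_step_num (n + 1) _ hs).elim
    | ifz _ _ h => rw [ih h]
  | appR M hs ih =>
    cases h' with
    | beta _ hV => exact (hV.not_step hs).elim
    | appR _ h => rw [ih h]
    | appL _ h => cases h
  | appL N hs ih =>
    cases h' with
    | beta => cases hs
    | appR => cases hs
    | appL _ h => rw [ih h]

theorem NormalForm.eq_of_steps {M N : Term} (hM : NormalForm M) (h : Steps M N) : M = N := by
  cases Relation.ReflTransGen.cases_head h with
  | inl h => exact h
  | inr h => exact (hM _ h.choose_spec.1).elim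

theorem NormalisesTo.unique {M R R' : Term} (h : NormalisesTo M R) (h' : NormalisesTo M R') :
    R = R' := by
  rcases Relation.ReflTransGen.total_of_right_unique (r := Step)
    (fun _ _ _ => Step.deterministic) h.1 h'.1 with hs | hs
  · exact h.2.eq_of_steps hs
  · exact (h'.2.eq_of_steps hs).symm

/-- This lets the left term of a basic pair `P ≲ N` run while the right one waits. -/
theorem Below.of_step {P P' N : Term} (h : Below P N) (hs : Step P P') : Below P' N :=
  fun _ hR => h _ ⟨hR.1.head hs, hR.2⟩

/-! ### Simulation -/

/-- The congruence closure of `≲` on closed terms and of the pairs of a fixpoint and its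
approximants of order at least `k`. -/
inductive Sim (k : ℕ) : Term → Term → Prop where
  | zero : Sim k zero zero
  | succ {M M' : Term} : Sim k M M' → Sim k (succ M) (succ M')
  | pred {M M' : Term} : Sim k M M' → Sim k (pred M) (pred M')
  | ifz {M M' N N' P P' : Term} :
      Sim k M M' → Sim k N N' → Sim k P P' → Sim k (ifz M N P) (ifz M' N' P')
  | var (i : ℕ) : Sim k (var i) (var i)
  | lam {M M' : Term} : Sim k M M' → Sim k (lam M) (lam M')
  | app {M M' N N' : Term} : Sim k M M' → Sim k N N' → Sim k (app M N) (app M' N')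
  | fix {M M' : Term} : Sim k M M' → Sim k (fix M) (fix M')
  | pair {M M' N N' : Term} : Sim k M M' → Sim k N N' → Sim k (pair M N) (pair M' N')
  | letp {M M' N N' : Term} : Sim k M M' → Sim k N N' → Sim k (letp M N) (letp M' N')
  | ofBelow {P N : Term} : P.Closed → N.Closed → Below P N → Sim k P N
  | approx {M M' : Term} {j : ℕ} : k ≤ j → Sim k M M' → Sim k (fix M) (fixApprox j M')

/-! ### Closure properties of the simulation -/

namespace Sim

theorem refl (k : ℕ) (M : Term) : Sim k M M := by
  induction M <;> constructor <;> assumption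

theorem mono {k l : ℕ} (hkl : k ≤ l) {M M' : Term} (h : Sim l M M') : Sim k M M' := by
  induction h with
  | ofBelow hP hN h => exact .ofBelow hP hN h
  | approx hj _ ih => exact .approx (hkl.trans hj) ih
  | _ => constructor <;> assumption

theorem rename {k : ℕ} {M M' : Term} (h : Sim k M M') (ρ : ℕ → ℕ) :
    Sim k (M.rename ρ) (M'.rename ρ) := by
  induction h generalizing ρ with
  | ofBelow hP hN h =>
    rw [hP.rename_eq, hN.rename_eq]
    exact .ofBelow hP hN h
  | approx hj _ ih =>
    rw [fixApprox_rename]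
    exact .approx hj (ih _)
  | _ => constructor <;> apply_assumption

theorem upSub {k : ℕ} {σ σ' : ℕ → Term} (h : ∀ i, Sim k (σ i) (σ' i)) :
    ∀ i, Sim k (upSub σ i) (upSub σ' i)
  | 0 => .var 0
  | i + 1 => (h i).rename _

/-- The two substitutions may differ, as in a beta step with similar arguments. This is why the
fixpoint rule of `Sim` must allow similar bodies instead of equal ones. -/
theorem subst {k : ℕ} {M M' : Term} (h : Sim k M M') {σ σ' : ℕ → Term}
    (hσ : ∀ i, Sim k (σ i) (σ' i)) : Sim k (M.subst σ) (M'.subst σ') := by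
  induction h generalizing σ σ' with
  | ofBelow hP hN h =>
    rw [hP.subst_eq, hN.subst_eq]
    exact .ofBelow hP hN h
  | approx hj _ ih =>
    rw [fixApprox_subst]
    exact .approx hj (ih (upSub hσ))
  | zero => exact .zero
  | var i => exact hσ i
  | succ _ ih => exact .succ (ih hσ)
  | pred _ ih => exact .pred (ih hσ)
  | lam _ ih => exact .lam (ih (upSub hσ))
  | fix _ ih => exact .fix (ih (upSub hσ))
  | app _ _ ih₁ ih₂ => exact .app (ih₁ hσ) (ih₂ hσ)
  | pair _ _ ih₁ ih₂ => exact .pair (ih₁ hσ) (ih₂ hσ)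
  | ifz _ _ _ ih₁ ih₂ ih₃ => exact .ifz (ih₁ hσ) (ih₂ hσ) (ih₃ hσ)
  | letp _ _ ih₁ ih₂ => exact .letp (ih₁ hσ) (ih₂ (upSub (upSub hσ)))

theorem inst {k : ℕ} {M M' N N' : Term} (hM : Sim k M M') (hN : Sim k N N') :
    Sim k (M.inst N) (M'.inst N') :=
  hM.subst fun i => by
    cases i with
    | zero => exact hN
    | succ i => exact .var i

theorem inst₂ {k : ℕ} {M M' V V' W W' : Term} (hM : Sim k M M') (hV : Sim k V V')
    (hW : Sim k W W') : Sim k (M.inst₂ V W) (M'.inst₂ V' W') :=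
  hM.subst fun i => by
    match i with
    | 0 => exact hW
    | 1 => exact hV
    | i + 2 => exact .var i

theorem fill {k : ℕ} {M M' : Term} (h : Sim k M M') (C : Ctx) :
    Sim k (C.fill M) (C.fill M') := by
  induction C with
  | hole ρ => exact h.rename ρ
  | _ => constructor <;> assumption

end Sim

/-- Simulation between values, hereditary along the outer pairs. -/
inductive ValueSim (k : ℕ) : Term → Term → Prop where
  | var (i : ℕ) : ValueSim k (var i) (var i)
  | num (n : ℕ) : ValueSim k (num n) (num n)
  | pair {V V' W W' : Term} :
      ValueSim k V V' → ValueSim k W W' → ValueSim k (pair V W) (pair V' W')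
  | lam {M M' : Term} : Sim k M M' → ValueSim k (lam M) (lam M')

/-! ### Inversion of similarity between values -/

namespace ValueSim

theorem refl (k : ℕ) {V : Term} (h : IsValue V) : ValueSim k V V := by
  induction h with
  | var i => exact .var i
  | num n => exact .num n
  | pair _ _ ih₁ ih₂ => exact .pair ih₁ ih₂
  | lam M => exact .lam (.refl k M)

theorem sim {k : ℕ} {V V' : Term} (h : ValueSim k V V') : Sim k V V' := by
  induction h with
  | var i => exact .var i
  | num n => exact .refl k _
  | pair _ _ ih₁ ih₂ => exact .pair ih₁ ih₂
  | lam h => exact .lam h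

theorem left {k : ℕ} {V V' : Term} (h : ValueSim k V V') : IsValue V := by
  induction h with
  | pair _ _ ih₁ ih₂ => exact .pair ih₁ ih₂
  | _ => constructor

theorem right {k : ℕ} {V V' : Term} (h : ValueSim k V V') : IsValue V' := by
  induction h with
  | pair _ _ ih₁ ih₂ => exact .pair ih₁ ih₂
  | _ => constructor

theorem eq_num_iff {k n : ℕ} {V V' : Term} (h : ValueSim k V V') :
    V = Term.num n ↔ V' = Term.num n := by
  cases h with
  | var | num => exact Iff.rfl
  | pair => exact ⟨fun h => (num_ne_pair _ _ _ h.symm).elim,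
      fun h => (num_ne_pair _ _ _ h.symm).elim⟩
  | lam => exact ⟨fun h => (num_ne_lam _ _ h.symm).elim, fun h => (num_ne_lam _ _ h.symm).elim⟩

theorem of_lam_left {k : ℕ} {M V : Term} (h : ValueSim k (Term.lam M) V) :
    ∃ M', V = Term.lam M' ∧ Sim k M M' := by
  generalize hU : Term.lam M = U at h
  cases h with
  | num n => exact (num_ne_lam _ _ hU.symm).elim
  | lam h => cases hU; exact ⟨_, rfl, h⟩
  | _ => cases hU

theorem of_lam_right {k : ℕ} {M V : Term} (h : ValueSim k V (Term.lam M)) :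
    ∃ M', V = Term.lam M' ∧ Sim k M' M := by
  generalize hU : Term.lam M = U at h
  cases h with
  | num n => exact (num_ne_lam _ _ hU.symm).elim
  | lam h => cases hU; exact ⟨_, rfl, h⟩
  | _ => cases hU

theorem of_pair_left {k : ℕ} {V W U : Term} (h : ValueSim k (Term.pair V W) U) :
    ∃ V' W', U = Term.pair V' W' ∧ ValueSim k V V' ∧ ValueSim k W W' := by
  generalize hU : Term.pair V W = U at h
  cases h with
  | num n => exact (num_ne_pair _ _ _ hU.symm).elim
  | pair h₁ h₂ => cases hU; exact ⟨_, _, rfl, h₁, h₂⟩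
  | _ => cases hU

theorem of_pair_right {k : ℕ} {V W U : Term} (h : ValueSim k U (Term.pair V W)) :
    ∃ V' W', U = Term.pair V' W' ∧ ValueSim k V' V ∧ ValueSim k W' W := by
  generalize hU : Term.pair V W = U at h
  cases h with
  | num n => exact (num_ne_pair _ _ _ hU.symm).elim
  | pair h₁ h₂ => cases hU; exact ⟨_, _, rfl, h₁, h₂⟩
  | _ => cases hU

end ValueSim

/-- Agreement of normal forms: similar values, or two terms that are not values. -/
def Agree (k : ℕ) (R R' : Term) : Prop :=
  ValueSim k R R' ∨ ¬ IsValue R ∧ ¬ IsValue R'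

theorem Agree.eq_num {k n : ℕ} {R R' : Term} (h : Agree k R R') (hR : R' = num n) : R = num n := by
  rcases h with h | h
  · exact h.eq_num_iff.2 hR
  · exact (h.2 (hR ▸ .num n)).elim

theorem Agree.eq_lam {k : ℕ} {R M' : Term} (h : Agree k R (lam M')) : ∃ M, R = lam M := by
  rcases h with h | h
  · exact ⟨_, h.of_lam_right.choose_spec.1⟩
  · exact (h.2 (.lam _)).elim

theorem Agree.isValue {k : ℕ} {R R' : Term} (h : Agree k R R') (hR : IsValue R') : IsValue R := by
  rcases h with h | h
  · exact h.left
  · exact (h.2 hR).elim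

theorem Agree.valueSim {k : ℕ} {R R' : Term} (h : Agree k R R') (hR : IsValue R) :
    ValueSim k R R' :=
  h.resolve_right fun h => h.1 hR

/-! ### Simulation of normal forms and of reductions -/

theorem Steps.lift {M M' : Term} (f : Term → Term) (hf : ∀ M M', Step M M' → Step (f M) (f M'))
    (h : Steps M M') : Steps (f M) (f M') :=
  Relation.ReflTransGen.lift f hf _ _ h

theorem not_isValue_pred (M : Term) : ¬ IsValue (pred M) := by
  generalize hU : pred M = U
  rintro (_ | n)
  any_goals cases hU
  cases n <;> cases hU

theorem not_isValue_ifz (M N P : Term) : ¬ IsValue (ifz M N P) := by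
  generalize hU : ifz M N P = U
  rintro (_ | n)
  any_goals cases hU
  cases n <;> cases hU

theorem not_isValue_app (M N : Term) : ¬ IsValue (app M N) := by
  generalize hU : app M N = U
  rintro (_ | n)
  any_goals cases hU
  cases n <;> cases hU

theorem not_isValue_letp (M N : Term) : ¬ IsValue (letp M N) := by
  generalize hU : letp M N = U
  rintro (_ | n)
  any_goals cases hU
  cases n <;> cases hU

/-- A term similar to a normal form reduces to a normal form that agrees with it. -/
theorem Sim.normalForm {k : ℕ} {S T : Term} (h : Sim k S T) (hS : NormalForm S) :
    ∃ T', NormalisesTo T T' ∧ Agree k S T' := by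
  induction h with
  | @ofBelow P N hP hN h =>
    -- `P` is its own normal form, so `N` reduces to `P` itself.
    refine ⟨P, h P ⟨.refl, hS⟩, ?_⟩
    by_cases hv : IsValue P
    · exact .inl (.refl k hv)
    · exact .inr ⟨hv, hv⟩
  | approx | fix => exact (hS _ (.unfold _)).elim
  | zero => exact ⟨_, ⟨.refl, hS⟩, .inl (.num 0)⟩
  | var i => exact ⟨_, ⟨.refl, hS⟩, .inl (.var i)⟩
  | lam h => exact ⟨_, ⟨.refl, (IsValue.lam _).normalForm⟩, .inl (.lam h)⟩
  | @succ M M' _ ih =>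
    obtain ⟨R, ⟨hs, hR⟩, ha⟩ := ih fun _ h => hS _ h.succ
    refine ⟨.succ R, ⟨hs.lift Term.succ fun _ _ => .succ, ?_⟩, ?_⟩
    · rintro _ (_ | h)
      exact hR _ (by assumption)
    · by_cases hv : IsValue (Term.succ M)
      · obtain ⟨n, rfl⟩ := hv.exists_num
        obtain rfl := (ha.valueSim (.num n)).eq_num_iff.1 rfl
        exact .inl (.num (n + 1))
      · refine .inr ⟨hv, fun h => hv ?_⟩
        obtain ⟨n, rfl⟩ := h.exists_num
        rw [ha.eq_num rfl]
        exact .num (n + 1)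
  | pred _ ih =>
    obtain ⟨R, ⟨hs, hR⟩, ha⟩ := ih fun _ h => hS _ h.pred
    refine ⟨.pred R, ⟨hs.lift Term.pred fun _ _ => .pred, fun U h => ?_⟩,
      .inr ⟨not_isValue_pred _, not_isValue_pred _⟩⟩
    cases h with
    | predZ =>
      obtain rfl := ha.eq_num (n := 0) rfl
      exact hS _ (.predZ)
    | predS n =>
      obtain rfl := ha.eq_num (n := n + 1) rfl
      exact hS _ (.predS n)
    | pred h => exact hR _ h
  | ifz _ _ _ ih =>
    obtain ⟨R, ⟨hs, hR⟩, ha⟩ := ih fun _ h => hS _ (h.ifz _ _)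
    refine ⟨.ifz R _ _, ⟨hs.lift (Term.ifz · _ _) fun _ _ h => .ifz _ _ h, fun U h => ?_⟩,
      .inr ⟨not_isValue_ifz _ _ _, not_isValue_ifz _ _ _⟩⟩
    cases h with
    | ifZ =>
      obtain rfl := ha.eq_num (n := 0) rfl
      exact hS _ (.ifZ _ _)
    | ifS n =>
      obtain rfl := ha.eq_num (n := n + 1) rfl
      exact hS _ (.ifS n _ _)
    | ifz _ _ h => exact hR _ h
  | letp _ _ ih =>
    obtain ⟨R, ⟨hs, hR⟩, ha⟩ := ih fun _ h => hS _ (h.letp _)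
    refine ⟨.letp R _, ⟨hs.lift (Term.letp · _) fun _ _ h => .letp _ h, fun U h => ?_⟩,
      .inr ⟨not_isValue_letp _ _, not_isValue_letp _ _⟩⟩
    cases h with
    | letPair _ hV hW =>
      have hv := ha.isValue (hV.pair hW)
      obtain ⟨V', W', rfl, h₁, h₂⟩ := (ha.valueSim hv).of_pair_right
      exact hS _ (.letPair _ h₁.left h₂.left)
    | letp _ h => exact hR _ h
  | @pair M M' N N' _ _ ih₁ ih₂ =>
    obtain ⟨R, ⟨hs, hR⟩, ha⟩ := ih₁ fun _ h => hS _ (h.pairL _)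
    have hs' := hs.lift (Term.pair · N') fun _ _ h => .pairL _ h
    by_cases hv : IsValue M
    · obtain ⟨R', ⟨hs₂, hR'⟩, ha'⟩ := ih₂ fun _ h => hS _ (h.pairR hv)
      have hM := ha.valueSim hv
      refine ⟨.pair R R', ⟨hs'.trans (hs₂.lift (Term.pair R) fun _ _ h => .pairR hM.right h),
        fun U h => ?_⟩, ?_⟩
      · cases h with
        | pairL _ h => exact hR _ h
        | pairR _ h => exact hR' _ h
      · rcases ha' with ha' | ha'
        · exact .inl (.pair hM ha')
        · exact .inr ⟨fun h => ha'.1 h.of_pair.2, fun h => ha'.2 h.of_pair.2⟩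
    -- The left component is stuck, so both pairs are stuck there and the right components never
    -- run.
    · have hv' : ¬ IsValue R := fun h => hv (ha.isValue h)
      refine ⟨.pair R N', ⟨hs', fun U h => ?_⟩,
        .inr ⟨fun h => hv h.of_pair.1, fun h => hv' h.of_pair.1⟩⟩
      cases h with
      | pairL _ h => exact hR _ h
      | pairR h _ => exact hv' h
  | @app M M' N N' _ _ ih₁ ih₂ =>
    obtain ⟨R, ⟨hs, hR⟩, ha⟩ := ih₁ fun _ h => hS _ (h.appL _)
    have hs' := hs.lift (Term.app · N') fun _ _ h => .appL _ h
    by_cases hl : ∃ L, M = .lam L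
    · obtain ⟨L, rfl⟩ := hl
      obtain ⟨L', rfl, -⟩ := (ha.valueSim (.lam L)).of_lam_left
      obtain ⟨R', ⟨hs₂, hR'⟩, ha'⟩ := ih₂ fun _ h => hS _ (h.appR _)
      refine ⟨.app (.lam L') R', ⟨hs'.trans (hs₂.lift (Term.app (.lam L')) fun _ _ h => .appR _ h),
        fun U h => ?_⟩, .inr ⟨not_isValue_app _ _, not_isValue_app _ _⟩⟩
      cases h with
      | beta _ hV => exact hS _ (.beta _ (ha'.isValue hV))
      | appR _ h => exact hR' _ h
      | appL _ h => exact hR _ h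
    -- By agreement `R` is not an abstraction either, so the argument `N'` is never evaluated.
    · refine ⟨.app R N', ⟨hs', fun U h => ?_⟩, .inr ⟨not_isValue_app _ _, not_isValue_app _ _⟩⟩
      cases h with
      | beta => exact hl ha.eq_lam
      | appR => exact hl ha.eq_lam
      | appL _ h => exact hR _ h

theorem Sim.value {k : ℕ} {V T : Term} (h : Sim k V T) (hV : IsValue V) :
    ∃ V', Steps T V' ∧ ValueSim k V V' := by
  obtain ⟨V', hs, ha⟩ := h.normalForm hV.normalForm
  exact ⟨V', hs.1, ha.valueSim hV⟩

/-- A reduction step is simulated at the cost of one level. -/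
theorem Sim.step {k : ℕ} {S S' T : Term} (h : Sim (k + 1) S T) (hS : Step S S') :
    ∃ T', Steps T T' ∧ Sim k S' T' := by
  have down {M M'} (h : Sim (k + 1) M M') : Sim k M M' := h.mono k.le_succ
  have num_steps {n M} (h : Sim (k + 1) (num n) M) : Steps M (num n) := by
    obtain ⟨V, hs, hV⟩ := h.value (.num n)
    rwa [hV.eq_num_iff.1 rfl] at hs
  induction h generalizing S' with
  | ofBelow hP hN h => exact ⟨_, .refl, .ofBelow (hS.closed hP) hN (h.of_step hS)⟩
  | @approx M M' j hj h =>
    cases hS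
    -- The level `k + 1` forces `j` to be positive. An approximant of successor order is by
    -- definition already the unfolded body, so the right term does not move; the inner approximant
    -- has lost one order.
    obtain ⟨j, rfl⟩ : ∃ i, j = i + 1 := ⟨j - 1, by omega⟩
    exact ⟨_, .refl, (down h).inst (.approx (by omega) (down h))⟩
  | zero | var | lam => cases hS
  | succ _ ih =>
    cases hS with
    | succ hS =>
      obtain ⟨T', hs, h⟩ := ih hS
      exact ⟨_, hs.lift Term.succ fun _ _ => .succ, .succ h⟩
  | pred h ih =>
    have hl {M M'} (h : Steps M M') := h.lift Term.pred fun _ _ => .pred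
    cases hS with
    | predZ => exact ⟨_, (hl (num_steps (n := 0) h)).tail .predZ, .refl _ _⟩
    | predS n => exact ⟨_, (hl (num_steps (n := n + 1) h)).tail (.predS n), .refl _ _⟩
    | pred hS =>
      obtain ⟨T', hs, h⟩ := ih hS
      exact ⟨_, hl hs, .pred h⟩
  | ifz h hN hP ih =>
    have hl {M M' N P} (h : Steps M M') := h.lift (Term.ifz · N P) fun _ _ h => .ifz _ _ h
    cases hS with
    | ifZ => exact ⟨_, (hl (num_steps (n := 0) h)).tail (.ifZ _ _), down hN⟩
    | ifS n => exact ⟨_, (hl (num_steps (n := n + 1) h)).tail (.ifS n _ _), down hP⟩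
    | ifz _ _ hS =>
      obtain ⟨T', hs, h⟩ := ih hS
      exact ⟨_, hl hs, .ifz h (down hN) (down hP)⟩
  | fix h =>
    cases hS
    exact ⟨_, .single (.unfold _), (down h).inst (.fix (down h))⟩
  | letp h hN ih =>
    have hl {M M' N} (h : Steps M M') := h.lift (Term.letp · N) fun _ _ h => .letp _ h
    cases hS with
    | letPair _ hV hW =>
      obtain ⟨U, hs, hU⟩ := h.value (hV.pair hW)
      obtain ⟨V', W', rfl, h₁, h₂⟩ := hU.of_pair_left
      exact ⟨_, (hl hs).tail (.letPair _ h₁.right h₂.right),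
        (down hN).inst₂ (down h₁.sim) (down h₂.sim)⟩
    | letp _ hS =>
      obtain ⟨T', hs, h⟩ := ih hS
      exact ⟨_, hl hs, .letp h (down hN)⟩
  | pair hM hN ih₁ ih₂ =>
    have hl {M M' N} (h : Steps M M') := h.lift (Term.pair · N) fun _ _ h => .pairL _ h
    cases hS with
    | pairL _ hS =>
      obtain ⟨T', hs, h⟩ := ih₁ hS
      exact ⟨_, hl hs, .pair h (down hN)⟩
    | pairR hV hS =>
      obtain ⟨V', hs₁, h₁⟩ := hM.value hV
      obtain ⟨T', hs₂, h₂⟩ := ih₂ hS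
      exact ⟨_, (hl hs₁).trans (hs₂.lift (Term.pair V') fun _ _ h => .pairR h₁.right h),
        .pair (down h₁.sim) h₂⟩
  | app hM hN ih₁ ih₂ =>
    have hl {M M' N} (h : Steps M M') := h.lift (Term.app · N) fun _ _ h => .appL _ h
    have hr {M N N'} (h : Steps N N') := h.lift (Term.app (.lam M)) fun _ _ h => .appR _ h
    cases hS with
    | beta L hV =>
      obtain ⟨U, hs₁, hU⟩ := hM.value (.lam L)
      obtain ⟨L', rfl, hL⟩ := hU.of_lam_left
      obtain ⟨V', hs₂, h₂⟩ := hN.value hV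
      exact ⟨_, ((hl hs₁).trans (hr hs₂)).tail (.beta _ h₂.right), (down hL).inst (down h₂.sim)⟩
    | appR L hS =>
      obtain ⟨U, hs₁, hU⟩ := hM.value (.lam L)
      obtain ⟨L', rfl, hL⟩ := hU.of_lam_left
      obtain ⟨T', hs₂, h₂⟩ := ih₂ hS
      exact ⟨_, (hl hs₁).trans (hr hs₂), .app (.lam (down hL)) h₂⟩
    | appL _ hS =>
      obtain ⟨T', hs, h⟩ := ih₁ hS
      exact ⟨_, hl hs, .app h (down hN)⟩

/-- Each step costs one level, so `n` is the length of the reduction of `S`. It depends neither on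
the right term nor on the level `k` that is left over. -/
theorem Sim.steps {S R : Term} (h : Steps S R) :
    ∃ n, ∀ k T, Sim (k + n) S T → ∃ T', Steps T T' ∧ Sim k R T' := by
  induction h using Relation.ReflTransGen.head_induction_on with
  | refl => exact ⟨0, fun k T h => ⟨T, .refl, h⟩⟩
  | head hs _ ih =>
    obtain ⟨n, ih⟩ := ih
    refine ⟨n + 1, fun k T h => ?_⟩
    obtain ⟨T₁, hs₁, h₁⟩ := Sim.step (k := k + n) h hs
    obtain ⟨T₂, hs₂, h₂⟩ := ih k T₁ h₁
    exact ⟨T₂, hs₁.trans hs₂, h₂⟩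

theorem Sim.normalisesTo {S R : Term} (h : NormalisesTo S R) :
    ∃ n, ∀ k T, Sim (k + n) S T → ∃ T', NormalisesTo T T' ∧ Agree k R T' := by
  obtain ⟨n, hn⟩ := Sim.steps h.1
  refine ⟨n, fun k T hT => ?_⟩
  obtain ⟨T₁, hs₁, h₁⟩ := hn k T hT
  obtain ⟨T₂, hs₂, h₂⟩ := h₁.normalForm h.2
  exact ⟨T₂, ⟨hs₁.trans hs₂.1, hs₂.2⟩, h₂⟩

/-! ### Types -/

theorem isValue_of_mem_sem {A : Ty} {V : Term} (h : V ∈ sem A) : IsValue V := by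
  induction A generalizing V with
  | ok => exact h.2
  | nat =>
    obtain ⟨n, rfl⟩ := h
    exact .num n
  | prod A B ih₁ ih₂ =>
    obtain ⟨V, hV, W, hW, rfl⟩ := h
    exact .pair (ih₁ hV) (ih₂ hW)
  | arrow | nec =>
    obtain ⟨-, M, rfl, -⟩ := h
    exact .lam M

/-- Normal forms are unique, so a normalising term of `semBot A` has no other result than its value
in `sem A`. -/
theorem mem_sem_of_normalisesTo {A : Ty} {M R : Term} (h : M ∈ semBot A)
    (hR : NormalisesTo M R) : R ∈ sem A := by
  rcases h.2 with ⟨V, hV, -, hv, hs⟩ | hd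
  · rwa [hR.unique ⟨hs, hv.normalForm⟩]
  · exact (hd ⟨R, hR⟩).elim

/-- Membership in a finitely verifiable type passes to similar closed values. -/
theorem FinitelyVerifiable.mem_sem {F : Ty} (hF : FinitelyVerifiable F) {k : ℕ} {V V' : Term}
    (h : ValueSim k V V') (hV : V ∈ sem F) (hc : V'.Closed) : V' ∈ sem F := by
  induction hF generalizing V V' with
  | ok => exact ⟨hc, h.right⟩
  | nat =>
    obtain ⟨n, hn⟩ := hV
    exact ⟨n, h.eq_num_iff.1 hn⟩
  | prod _ _ ih₁ ih₂ =>
    obtain ⟨V, hV, W, hW, rfl⟩ := hV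
    obtain ⟨V', W', rfl, h₁, h₂⟩ := h.of_pair_left
    exact ⟨V', ih₁ h₁ hV hc.1, W', ih₂ h₂ hW hc.2, rfl⟩

/-- The limit property for values is a hypothesis here, so that the arrow case of the induction on
types can supply it from its induction hypothesis. -/
theorem mem_semBot_of_forall_sim_of_sem {A : Ty}
    (hA : ∀ (R : Term) (R' : ℕ → Term), R.Closed → (∀ k, ValueSim k R (R' k)) →
      (∀ k, R' k ∈ sem A) → R ∈ sem A)
    {S : Term} {T : ℕ → Term} (hS : S.Closed) (h : ∀ k, Sim k S (T k))
    (hT : ∀ k, T k ∈ semBot A) : S ∈ semBot A := by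
  refine ⟨hS, ?_⟩
  by_cases hd : Diverges S
  · exact .inr hd
  obtain ⟨R, hR⟩ := not_not.1 hd
  obtain ⟨n, hn⟩ := Sim.normalisesTo hR
  -- Shifting the sequence by `n` pays for the reduction of `S` and leaves level `k` for the
  -- results.
  choose R' hR' ha using fun k => hn k (T (k + n)) (h _)
  have hmem k : R' k ∈ sem A := mem_sem_of_normalisesTo (hT _) (hR' k)
  -- One index is enough to exclude that `R` is stuck.
  have hv : IsValue R := (ha 0).isValue (isValue_of_mem_sem (hmem 0))
  exact .inl ⟨R, hA R R' (hR.1.closed hS) (fun k => (ha k).valueSim hv) hmem, hS, hv, hR.1⟩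

/-- A single level would not do: the level needed at an arrow depends on how long the body runs on
the given argument. All levels together cover every argument. -/
theorem mem_sem_of_forall_valueSim {A : Ty} (hA : IsType A) {R : Term} {R' : ℕ → Term}
    (hR : R.Closed) (h : ∀ k, ValueSim k R (R' k)) (hR' : ∀ k, R' k ∈ sem A) : R ∈ sem A := by
  induction hA generalizing R R' with
  | ok => exact ⟨hR, (h 0).left⟩
  | nat =>
    obtain ⟨n, hn⟩ := hR' 0
    exact ⟨n, (h 0).eq_num_iff.2 hn⟩
  | prod _ _ ih₁ ih₂ =>
    choose V hV W hW heq using hR'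
    obtain ⟨V₀, W₀, rfl, -, -⟩ := (heq 0 ▸ h 0).of_pair_right
    have hVW k : ValueSim k V₀ (V k) ∧ ValueSim k W₀ (W k) := by
      obtain ⟨V', W', he, h₁, h₂⟩ := (h k).of_pair_left
      cases (heq k).symm.trans he
      exact ⟨h₁, h₂⟩
    exact ⟨V₀, ih₁ hR.1 (fun k => (hVW k).1) hV, W₀, ih₂ hR.2 (fun k => (hVW k).2) hW, rfl⟩
  | arrow _ _ _ ih =>
    choose _ M heq hM using hR'
    obtain ⟨M₀, rfl, -⟩ := (heq 0 ▸ h 0).of_lam_right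
    refine ⟨hR, M₀, rfl, fun V hV hVA => ?_⟩
    refine mem_semBot_of_forall_sim_of_sem (fun _ _ => ih) (ClosedAt.inst hR hV.1) (fun k => ?_)
      fun k => hM k V hV hVA
    obtain ⟨M', he, hs⟩ := (h k).of_lam_left
    cases (heq k).symm.trans he
    exact hs.inst (.refl k V)
  | nec _ hF _ =>
    choose hc M heq hM using hR'
    obtain ⟨M₀, rfl, -⟩ := (heq 0 ▸ h 0).of_lam_right
    refine ⟨hR, M₀, rfl, fun V hV hVF => ?_⟩
    obtain ⟨W, hW, -, hv, hs⟩ := hVF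
    -- The terminating run of `M₀[V]` fixes a level `n`, and the one function `R' (0 + n)` then
    -- returns a similar value, still in the finitely verifiable type. Its necessity property
    -- applies to the same `V`, so no limit in the argument type is needed.
    obtain ⟨n, hn⟩ := Sim.normalisesTo ⟨hs, hv.normalForm⟩
    obtain ⟨M', he, hsim⟩ := (h (0 + n)).of_lam_left
    cases (heq _).symm.trans he
    obtain ⟨W', hW', ha⟩ := hn 0 _ (hsim.inst (.refl _ V))
    have hWW := ha.valueSim hv
    have hcl : ((M (0 + n)).inst V).Closed := by
      have := hc (0 + n)
      rw [heq] at this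
      exact ClosedAt.inst this hV.1
    exact hM _ V hV ⟨W', hF.mem_sem hWW hW (hW'.1.closed hcl), hcl, hWW.right, hW'.1⟩

/-- Types are closed under limits of simulations. -/
theorem mem_semBot_of_forall_sim {A : Ty} (hA : IsType A) {S : Term} {T : ℕ → Term}
    (hS : S.Closed) (h : ∀ k, Sim k S (T k)) (hT : ∀ k, T k ∈ semBot A) : S ∈ semBot A :=
  mem_semBot_of_forall_sim_of_sem (fun _ _ => mem_sem_of_forall_valueSim hA) hS h hT

end TwoSided

theorem mainTheorem2 (A : TwoSided.Ty) (hA : TwoSided.IsType A) (C : TwoSided.Ctx) :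
    (∀ N P : TwoSided.Term, N.Closed → P.Closed → TwoSided.Below P N →
      C.fill N ∈ TwoSided.semBot A → C.fill P ∈ TwoSided.semBot A) ∧
    (∀ M : TwoSided.Term, C.fill (TwoSided.Term.fix M) ∉ TwoSided.semBot A →
      ∃ k : ℕ, C.fill (TwoSided.Term.fixApprox k M) ∉ TwoSided.semBot A) := by
  open TwoSided in
  refine ⟨fun N P hN hP hPN h => ?_, fun M hM => ?_⟩
  -- The basic pairs `P ≲ N` lie in every level, so a constant sequence serves.
  · refine mem_semBot_of_forall_sim hA (C.fill_closedAt (fun ρ n _ => ?_) h.1)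
      (fun k => (Sim.ofBelow hP hN hPN).fill C) fun _ => h
    exact Term.ClosedAt.rename (m := 0) hP fun _ hi => absurd hi (Nat.not_lt_zero _)
  · by_contra! hk
    -- Closedness of `C[fix x. M]` is read off from order `1`: `M[div/x]` keeps the free variables
    -- of `fix x. M`, whereas order `0` is `div` and forgets them.
    refine hM (mem_semBot_of_forall_sim hA (C.fill_closedAt (fun ρ n hn => ?_) (hk 1).1)
      (fun k => (Sim.approx le_rfl (.refl k M)).fill C) hk)
    rw [Term.fixApprox_rename] at hn
    exact Term.ClosedAt.of_inst hn
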